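/- Consider finite plane (rooted, ordered) trees whose nodes carry integer labels such that the root has label $0$ and the labels of any two adjacent nodes differ by $\pm 1$. For $n\ge 0$ let $\mathcal T_{0,n}$ be the (finite) set of such labelled trees with $n$ edges, endowed with the uniform distribution. For $j\in\mathbb Z$ let $X_n^+(j)$ be the number of nodes with label at least $j$ in a random tree of $\mathcal T_{0,n}$, and for $x\in\mathbb R$ put $X_n^+(x)=X_n^+(\lceil x\rceil)$. Then for every real $\lambda\ge 0$ the series below converges absolutely, and as $n\to\infty$, $$\mathbb E\left(\frac{X_n^+(\lambda n^{1/4})}{n}\right)\longrightarrow \frac{1}{2\sqrt{\pi}}\sum_{m\ge 0}\frac{(-2\lambda)^m}{m!}\cos\left(\frac{m\pi}{4}\right)\Gamma\left(\frac{m+2}{4}\right).$$ -/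

import Mathlib

open MeasureTheory ProbabilityTheory Filter Topology

/-- A finite plane (rooted, ordered) tree whose nodes carry integer labels: the root label and the
ordered list of the subtrees attached to the root. -/
inductive LabelledTree : Type
  | node (label : ℤ) (children : List LabelledTree) : LabelledTree

namespace LabelledTree

/-- The label of the root. -/
def rootLabel : LabelledTree → ℤ
  | node a _ => a

/-- The number of edges: every child of a node contributes the edge that joins it to the node. -/
def numEdges : LabelledTree → ℕ
  | node _ ts => (ts.map fun t => numEdges t + 1).sum

/-- The number of nodes whose label is at least `j`. -/
def numNodesGE (j : ℤ) : LabelledTree → ℕ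
  | node a ts => (if j ≤ a then 1 else 0) + (ts.map fun t => numNodesGE j t).sum

/-- The labels of any two adjacent nodes differ by `1` or `-1`. -/
inductive HasUnitIncrements : LabelledTree → Prop
  | node (a : ℤ) (ts : List LabelledTree)
      (root_edges : ∀ t ∈ ts, t.rootLabel = a + 1 ∨ t.rootLabel = a - 1)
      (subtrees : ∀ t ∈ ts, HasUnitIncrements t) : HasUnitIncrements (node a ts)

/-- The plane trees with `n` edges whose root has label `a` and whose labels vary by `±1` along
each edge. -/
def treesRootedAt (a : ℤ) (n : ℕ) : Set LabelledTree :=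
  {t | t.rootLabel = a ∧ t.HasUnitIncrements ∧ t.numEdges = n}

/-- All sets of trees are events. -/
instance : MeasurableSpace LabelledTree := ⊤

instance : DiscreteMeasurableSpace LabelledTree := ⟨fun _ => trivial⟩

/-- The uniform distribution on the labelled trees with `n` edges and root label `0`. -/
noncomputable def uniformLaw (n : ℕ) : Measure LabelledTree :=
  uniformOn (treesRootedAt 0 n)

/-- The number of nodes with label at least `⌈x⌉`, for a real number `x`. -/
noncomputable def numNodesGEReal (x : ℝ) (t : LabelledTree) : ℕ :=
  t.numNodesGE ⌈x⌉

/-! The uniform distribution above is over a finite non-empty set, hence a probability measure. -/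

theorem finite_numEdges_le (n : ℕ) : ∀ a : ℤ,
    {t : LabelledTree | t.rootLabel = a ∧ t.HasUnitIncrements ∧ t.numEdges ≤ n}.Finite := by
  induction n with
  | zero =>
    intro a
    refine (Set.finite_singleton (node a [])).subset ?_
    rintro ⟨b, ts⟩ ⟨h1, -, h3⟩
    cases ts with
    | nil => simpa [rootLabel] using h1
    | cons t ts => simp [numEdges] at h3
  | succ n ih =>
    intro a
    have hF := (ih (a + 1)).union (ih (a - 1))
    set F := {t : LabelledTree | t.rootLabel = a + 1 ∧ t.HasUnitIncrements ∧ t.numEdges ≤ n} ∪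
      {t : LabelledTree | t.rootLabel = a - 1 ∧ t.HasUnitIncrements ∧ t.numEdges ≤ n} with hFdef
    have : Finite F := hF
    refine ((List.finite_length_le F (n + 1)).image
      fun l => node a (l.map Subtype.val)).subset ?_
    rintro ⟨b, ts⟩ ⟨h1, h2, h3⟩
    obtain rfl : b = a := h1
    obtain ⟨_, _, hr, hs⟩ := h2
    rw [numEdges] at h3
    have hmem : ∀ t ∈ ts, t ∈ F := by
      intro t ht
      have h4 : t.numEdges + 1 ≤ (ts.map fun t => numEdges t + 1).sum :=
        List.le_sum_of_mem (List.mem_map.2 ⟨t, ht, rfl⟩)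
      rcases hr t ht with h | h
      · exact Or.inl ⟨h, hs t ht, by omega⟩
      · exact Or.inr ⟨h, hs t ht, by omega⟩
    have hlen : ts.length ≤ (ts.map fun t => numEdges t + 1).sum := by
      simp
    refine ⟨ts.attach.map fun t => ⟨t.1, hmem t.1 t.2⟩, ?_, ?_⟩
    · simpa using hlen.trans h3
    · simp [Function.comp_def]

theorem treesRootedAt_finite (a : ℤ) (n : ℕ) : (treesRootedAt a n).Finite :=
  (finite_numEdges_le n a).subset fun _ h => ⟨h.1, h.2.1, h.2.2.le⟩

theorem treesRootedAt_nonempty (n : ℕ) : ∀ a : ℤ, (treesRootedAt a n).Nonempty := by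
  induction n with
  | zero => exact fun a => ⟨node a [], rfl, .node _ _ (by simp) (by simp), by simp [numEdges]⟩
  | succ n ih =>
    intro a
    obtain ⟨t, h1, h2, h3⟩ := ih (a + 1)
    exact ⟨node a [t], rfl, .node _ _ (by simp [h1]) (by simpa using h2), by simp [numEdges, h3]⟩

instance (n : ℕ) : IsProbabilityMeasure (uniformLaw n) :=
  isProbabilityMeasure_uniformOn (treesRootedAt_finite 0 n) (treesRootedAt_nonempty n 0)

end LabelledTree

/-! Along the path from the root to a node at depth `d` the labels form a simple random walk `W`, so
the expected number of nodes with label at least `k` is `n + 1` times `P(W_D ≥ k)`, where `D` is the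
depth of a uniform node of a uniform plane tree. Generating series give this exactly
(`totalNodesGE_eq`, `integral_numNodesGE`), the depth `d` having the ballot number `C(2n, n+d) -
C(2n, n+d+1)` as weight.

By reflection, `P(W_d ≥ k) + P(W_d ≥ k+1)` is the probability that `k` is hit by time `d`. Abel
summation turns the ballot weights into `C(2n, n+d)` and these probabilities into the law of the
hitting time, whose generating function is `(z / (1 + √(1 - z²)))^k` (`hitGF_eq_pow`). As `C(2n,
n+d)` is a Fourier coefficient of `(2 cos(θ/2))^(2n)`, the sum of two consecutive tails is an
integral over the unit circle (`integral_cos_pow_mul_hitRoot`).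

With `θ = s/√n` and `k ~ λ n^(1/4)`, dominated convergence yields `∫ exp(-s²/4) exp(-λ √(-2is)) ds`
(`tendsto_scaledIntegral`). Expanding the second exponential gives Gamma integrals and the stated
series (`hasSum_limitIntegral`). Monotonicity in `k` recovers a single tail from the sums of two
(`tendsto_nodeTail`). -/

namespace LabelledTree

/-! ### Decomposition at the first subtree, and generating series. -/

/-- The tree obtained by adding `t` as the first subtree of the root of the second tree. -/
def graft (t : LabelledTree) : LabelledTree → LabelledTree
  | node a ts => node a (t :: ts)

theorem rootLabel_graft (t s : LabelledTree) : (graft t s).rootLabel = s.rootLabel := by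
  cases s; rfl

theorem numEdges_graft (t s : LabelledTree) :
    (graft t s).numEdges = t.numEdges + 1 + s.numEdges := by
  cases s; simp [graft, numEdges]

theorem numNodesGE_graft (j : ℤ) (t s : LabelledTree) :
    (graft t s).numNodesGE j = t.numNodesGE j + s.numNodesGE j := by
  cases s; simp [graft, numNodesGE]; omega

theorem hasUnitIncrements_graft (t s : LabelledTree) : (graft t s).HasUnitIncrements ↔
    (t.rootLabel = s.rootLabel + 1 ∨ t.rootLabel = s.rootLabel - 1) ∧ t.HasUnitIncrements ∧
      s.HasUnitIncrements := by
  cases s with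
  | node a ts =>
    constructor
    · rintro ⟨_, _, hr, hs⟩
      refine ⟨hr t (by simp), hs t (by simp), .node _ _ ?_ ?_⟩
      · exact fun x hx => hr x (by simp [hx])
      · exact fun x hx => hs x (by simp [hx])
    · rintro ⟨h1, h2, ⟨_, _, hr, hs⟩⟩
      refine .node _ _ ?_ ?_
      · intro x hx
        rcases List.mem_cons.1 hx with rfl | hx
        · exact h1
        · exact hr x hx
      · intro x hx
        rcases List.mem_cons.1 hx with rfl | hx
        · exact h2
        · exact hs x hx

theorem graft_injective2 : Function.Injective2 graft := by
  rintro t t' ⟨a, ts⟩ ⟨a', ts'⟩ h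
  simp only [graft, node.injEq, List.cons.injEq] at h
  obtain ⟨rfl, rfl, rfl⟩ := h
  simp

theorem exists_eq_graft {t : LabelledTree} (h : t.numEdges ≠ 0) : ∃ s s', t = graft s s' := by
  rcases t with ⟨a, _ | ⟨s, ts⟩⟩
  · simp [numEdges] at h
  · exact ⟨s, node a ts, rfl⟩

/-- The finite set underlying `treesRootedAt a n`. -/
noncomputable def treeFinset (a : ℤ) (n : ℕ) : Finset LabelledTree :=
  (treesRootedAt_finite a n).toFinset

theorem mem_treeFinset {a : ℤ} {n : ℕ} {t : LabelledTree} : t ∈ treeFinset a n ↔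
    t.rootLabel = a ∧ t.HasUnitIncrements ∧ t.numEdges = n := by
  simp [treeFinset, treesRootedAt]

theorem treeFinset_zero (a : ℤ) : treeFinset a 0 = {node a []} := by
  ext t
  rw [mem_treeFinset, Finset.mem_singleton]
  constructor
  · rintro ⟨h1, -, h3⟩
    rcases t with ⟨b, _ | ⟨s, ts⟩⟩
    · simpa [rootLabel] using h1
    · simp [numEdges] at h3
  · rintro rfl
    exact ⟨rfl, .node _ _ (by simp) (by simp), by simp [numEdges]⟩

-- A tree with at least one edge is in a unique way its first subtree grafted onto the rest. The
-- sigma type records the label `a ± 1` of the root of that subtree.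
open Finset in
theorem sum_treeFinset_succ (a : ℤ) (n : ℕ) (f : LabelledTree → ℝ) :
    ∑ t ∈ treeFinset a (n + 1), f t = ∑ p ∈ antidiagonal n,
      (∑ t ∈ treeFinset (a + 1) p.1, ∑ s ∈ treeFinset a p.2, f (graft t s) +
        ∑ t ∈ treeFinset (a - 1) p.1, ∑ s ∈ treeFinset a p.2, f (graft t s)) := by
  have key : ∀ p : ℕ × ℕ,
      (∑ t ∈ treeFinset (a + 1) p.1, ∑ s ∈ treeFinset a p.2, f (graft t s) +
        ∑ t ∈ treeFinset (a - 1) p.1, ∑ s ∈ treeFinset a p.2, f (graft t s)) =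
      ∑ x ∈ ({a + 1, a - 1} : Finset ℤ).sigma
        (fun b => treeFinset b p.1 ×ˢ treeFinset a p.2), f (graft x.2.1 x.2.2) := by
    intro p
    rw [sum_sigma, sum_pair (by omega), sum_product, sum_product]
  simp_rw [key]
  rw [sum_sigma']
  symm
  refine sum_bij (fun x _ => graft x.2.2.1 x.2.2.2) ?_ ?_ ?_ (fun _ _ => rfl)
  · rintro ⟨⟨k, l⟩, b, t, s⟩ hx
    simp only [mem_sigma, Finset.HasAntidiagonal.mem_antidiagonal, mem_product, mem_treeFinset, mem_insert,
      mem_singleton] at hx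
    obtain ⟨h1, h2, ⟨h3, h4, h5⟩, h6, h7, h8⟩ := hx
    rw [mem_treeFinset, rootLabel_graft, hasUnitIncrements_graft, numEdges_graft]
    refine ⟨h6, ⟨?_, h4, h7⟩, by dsimp only; omega⟩
    simpa [h3, h6] using h2
  · rintro ⟨⟨k, l⟩, b, t, s⟩ hx ⟨⟨k', l'⟩, b', t', s'⟩ hx' h
    simp only [mem_sigma, Finset.HasAntidiagonal.mem_antidiagonal, mem_product, mem_treeFinset, mem_insert,
      mem_singleton] at hx hx'
    obtain ⟨rfl, rfl⟩ := graft_injective2 h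
    obtain ⟨h1, h2, ⟨rfl, h4, rfl⟩, h6, h7, rfl⟩ := hx
    obtain ⟨h1', h2', ⟨rfl, h4', rfl⟩, h6', h7', rfl⟩ := hx'
    rfl
  · intro t ht
    rw [mem_treeFinset] at ht
    obtain ⟨h1, h2, h3⟩ := ht
    obtain ⟨s, s', rfl⟩ := exists_eq_graft (t := t) (by omega)
    rw [rootLabel_graft] at h1
    rw [hasUnitIncrements_graft] at h2
    rw [numEdges_graft] at h3
    refine ⟨⟨(s.numEdges, s'.numEdges), s.rootLabel, s, s'⟩, ?_, rfl⟩
    simp only [mem_sigma, Finset.HasAntidiagonal.mem_antidiagonal, mem_product, mem_treeFinset, mem_insert,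
      mem_singleton, true_and, and_true]
    exact ⟨by omega, by simpa [h1] using h2.1, h2.2.1, h1, h2.2.2⟩

/-- The total number of nodes with label at least `j`, over all trees in `treesRootedAt a n`. -/
noncomputable def totalNodesGE (j a : ℤ) (n : ℕ) : ℝ :=
  ∑ t ∈ treeFinset a n, (t.numNodesGE j : ℝ)

theorem totalNodesGE_def (j a : ℤ) (n : ℕ) :
    totalNodesGE j a n = ∑ t ∈ treeFinset a n, (t.numNodesGE j : ℝ) := rfl

theorem card_treeFinset_eq (n : ℕ) : ∀ a b : ℤ, (treeFinset a n).card = (treeFinset b n).card := by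
  induction n using Nat.strong_induction_on with
  | _ n ih =>
    intro a b
    rcases n with _ | n
    · simp [treeFinset_zero]
    · have h : ∀ a, ((treeFinset a (n + 1)).card : ℝ) =
          ∑ t ∈ treeFinset a (n + 1), (1 : ℝ) := by simp
      rw [← Nat.cast_inj (R := ℝ), h, h, sum_treeFinset_succ, sum_treeFinset_succ]
      refine Finset.sum_congr rfl fun p hp => ?_
      have := Finset.HasAntidiagonal.mem_antidiagonal.1 hp
      simp only [Finset.sum_const, nsmul_eq_mul, mul_one]
      rw [ih p.1 (by omega) (a + 1) (b + 1), ih p.1 (by omega) (a - 1) (b - 1),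
        ih p.2 (by omega) a b]

/-- The generating series of the labelled trees, each weighted by `2 ^ (-numEdges)`. -/
noncomputable def treeSeries : PowerSeries ℝ :=
  PowerSeries.mk fun n => ((treeFinset 0 n).card : ℝ) / 2 ^ n

/-- The generating series of the labelled trees with a marked node of label at least `j`, each
weighted by `2 ^ (-numEdges)`. -/
noncomputable def markedSeries (j a : ℤ) : PowerSeries ℝ :=
  PowerSeries.mk fun n => totalNodesGE j a n / 2 ^ n

open PowerSeries

theorem treeSeries_eq : treeSeries = 1 + X * (treeSeries * treeSeries) := by
  ext n
  rcases n with _ | n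
  · simp [treeSeries, treeFinset_zero]
  · have h : ((treeFinset 0 (n + 1)).card : ℝ) =
          ∑ t ∈ treeFinset 0 (n + 1), (1 : ℝ) := by simp
    rw [map_add, coeff_succ_X_mul, coeff_mul, coeff_one, if_neg (by omega), zero_add]
    simp only [treeSeries, coeff_mk]
    rw [h, sum_treeFinset_succ, Finset.sum_div]
    refine Finset.sum_congr rfl fun p hp => ?_
    have := Finset.HasAntidiagonal.mem_antidiagonal.1 hp
    simp only [Finset.sum_const, nsmul_eq_mul, mul_one]
    rw [card_treeFinset_eq p.1 (0 + 1) 0, card_treeFinset_eq p.1 (0 - 1) 0, ← this, pow_succ,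
      pow_add]
    field_simp
    ring

/-- A marked node other than the root of a single-node tree lies in the first subtree or in the
rest. The new edge weighs `1/2`; in the second case the two possible labels of the unmarked subtree
cancel it. -/
theorem markedSeries_eq (j a : ℤ) : markedSeries j a = C (if j ≤ a then (1 : ℝ) else 0) +
    X * (C (1 / 2) * (treeSeries * (markedSeries j (a + 1) + markedSeries j (a - 1))) +
      treeSeries * markedSeries j a) := by
  ext n
  rcases n with _ | n
  · simp [markedSeries, totalNodesGE, treeFinset_zero, numNodesGE]
  · rw [map_add, coeff_succ_X_mul, map_add, coeff_C_mul, coeff_mul, coeff_mul, coeff_C,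
      if_neg (by omega), zero_add]
    simp only [markedSeries, treeSeries, coeff_mk, map_add]
    rw [Finset.mul_sum, ← Finset.sum_add_distrib, totalNodesGE, sum_treeFinset_succ,
      Finset.sum_div, ← Finset.Nat.sum_antidiagonal_swap]
    have hsw : ∑ p ∈ Finset.HasAntidiagonal.antidiagonal n, ((treeFinset 0 p.1).card : ℝ) / 2 ^ p.1 *
        (totalNodesGE j a p.2 / 2 ^ p.2) = ∑ p ∈ Finset.HasAntidiagonal.antidiagonal n,
        ((treeFinset 0 p.2).card : ℝ) / 2 ^ p.2 * (totalNodesGE j a p.1 / 2 ^ p.1) := by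
      rw [← Finset.Nat.sum_antidiagonal_swap]; rfl
    rw [Finset.sum_add_distrib, hsw, ← Finset.sum_add_distrib]
    refine Finset.sum_congr rfl fun p hp => ?_
    have := Finset.HasAntidiagonal.mem_antidiagonal.1 hp
    simp only [numNodesGE_graft, Nat.cast_add, Finset.sum_add_distrib, Finset.sum_const,
      nsmul_eq_mul, Prod.fst_swap, Prod.snd_swap, ← Finset.mul_sum]
    simp only [← totalNodesGE_def]
    rw [card_treeFinset_eq p.1 a 0, card_treeFinset_eq p.2 (a + 1) 0,
      card_treeFinset_eq p.2 (a - 1) 0, ← this, pow_succ, pow_add]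
    field_simp
    ring

end LabelledTree

/-! ### Random walk tails and ballot numbers. -/

/-- `walkTail d k` is the probability that the simple random walk is at least `k` at time `d`. -/
noncomputable def walkTail : ℕ → ℤ → ℝ
  | 0, k => if k ≤ 0 then 1 else 0
  | d + 1, k => (walkTail d (k - 1) + walkTail d (k + 1)) / 2

/-- Symmetry of the walk: `W ≥ 1 - k` means `-W < k`. -/
theorem walkTail_symm (d : ℕ) : ∀ k, walkTail d k + walkTail d (1 - k) = 1 := by
  induction d with
  | zero =>
    intro k
    simp only [walkTail]
    split_ifs <;> first | omega | norm_num
  | succ d ih =>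
    intro k
    have h1 := ih (k - 1)
    have h2 := ih (k + 1)
    simp only [walkTail]
    rw [show 1 - (k - 1) = 1 - k + 1 by ring] at h1
    rw [show 1 - (k + 1) = 1 - k - 1 by ring] at h2
    linarith

theorem walkTail_antitone (d : ℕ) : ∀ k, walkTail d (k + 1) ≤ walkTail d k := by
  induction d with
  | zero =>
    intro k
    simp only [walkTail]
    split_ifs <;> first | omega | norm_num
  | succ d ih =>
    intro k
    have h1 := ih (k - 1)
    have h2 := ih (k + 1)
    simp only [walkTail]
    rw [show k - 1 + 1 = k by ring] at h1
    rw [show k + 1 - 1 = k by ring]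
    linarith

/-- The number of plane trees with `n` edges and a marked node at depth `d`. -/
noncomputable def markedTrees (n d : ℕ) : ℝ :=
  ((2 * n).choose (n + d) : ℝ) - ((2 * n).choose (n + d + 1) : ℝ)

theorem choose_two_mul_succ (n d : ℕ) : (2 * (n + 1)).choose (n + 1 + (d + 1)) =
    (2 * n).choose (n + d) + 2 * (2 * n).choose (n + d + 1) + (2 * n).choose (n + d + 2) := by
  rw [show 2 * (n + 1) = 2 * n + 1 + 1 by ring, show n + 1 + (d + 1) = n + d + 1 + 1 by ring,
    Nat.choose_succ_succ, Nat.choose_succ_succ, Nat.choose_succ_succ]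
  ring

theorem choose_two_mul_succ_self (n : ℕ) : (2 * (n + 1)).choose (n + 1) =
    2 * (2 * n).choose n + 2 * (2 * n).choose (n + 1) := by
  rcases n with _ | n
  · rfl
  · rw [show 2 * (n + 1 + 1) = 2 * (n + 1) + 1 + 1 by ring,
      Nat.choose_succ_succ, Nat.choose_succ_succ, Nat.choose_succ_succ _ (n + 1)]
    have := Nat.choose_symm_of_eq_add (n := 2 * (n + 1)) (a := n) (b := n + 1 + 1) (by ring)
    rw [this]
    ring

theorem markedTrees_succ_succ (n d : ℕ) : markedTrees (n + 1) (d + 1) =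
    markedTrees n d + 2 * markedTrees n (d + 1) + markedTrees n (d + 2) := by
  have h := choose_two_mul_succ n d
  have h' := choose_two_mul_succ n (d + 1)
  simp only [markedTrees]
  rw [h, show n + 1 + (d + 1) + 1 = n + 1 + (d + 1 + 1) by ring, h']
  push_cast
  simp only [← add_assoc]
  ring

theorem markedTrees_succ_zero (n : ℕ) : markedTrees (n + 1) 0 =
    markedTrees n 0 + markedTrees n 1 := by
  have h := choose_two_mul_succ n 0
  have h' := choose_two_mul_succ_self n
  simp only [markedTrees, add_zero] at h ⊢
  rw [h', show n + 1 + 1 = n + 1 + (0 + 1) by ring, h]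
  push_cast
  ring

/-! ### Exact formula for the expectation. -/

namespace LabelledTree
open PowerSeries

/-- With `Z = X T²` and `T = 1 + Z` one has `Z = X (1 + Z)²`, so the series `T Z^d` obey the
recursion that Pascal's rule, applied twice, gives for `markedTrees`. -/
theorem coeff_treeSeries_mul_pow (n : ℕ) : ∀ d : ℕ,
    coeff n (treeSeries * (X * (treeSeries * treeSeries)) ^ d) = markedTrees n d := by
  set Z := X * (treeSeries * treeSeries) with hZ
  have hc : treeSeries = 1 + Z := treeSeries_eq
  have hZ2 : Z = X * (1 + 2 * Z + Z ^ 2) := by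
    conv_lhs => rw [hZ, hc]
    ring
  induction n with
  | zero =>
    intro d
    have h0 : constantCoeff Z = (0 : ℝ) := by simp [hZ]
    have h1 : constantCoeff treeSeries = (1 : ℝ) := by rw [hc]; simp [h0]
    rcases d with _ | d
    · simp [markedTrees, h1]
    · simp [markedTrees, h0, Nat.choose_eq_zero_of_lt]
  | succ n ih =>
    intro d
    rcases d with _ | d
    · have : treeSeries * Z ^ 0 = 1 + X * (treeSeries * Z ^ 0 + treeSeries * Z ^ 1) := by
        conv_lhs => rw [hc, hZ]
        rw [pow_zero, pow_one]
        linear_combination X * treeSeries * hc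
      rw [this, map_add, coeff_succ_X_mul, map_add, ih, ih, markedTrees_succ_zero, coeff_one]
      simp
    · have : treeSeries * Z ^ (d + 1) = X * (treeSeries * Z ^ d + treeSeries * Z ^ (d + 1) +
          treeSeries * Z ^ (d + 1) + treeSeries * Z ^ (d + 2)) := by
        calc treeSeries * Z ^ (d + 1) = treeSeries * Z ^ d * Z := by ring
          _ = treeSeries * Z ^ d * (X * (1 + 2 * Z + Z ^ 2)) := by rw [← hZ2]
          _ = _ := by ring
      rw [this, coeff_succ_X_mul, map_add, map_add, map_add, ih, ih, ih, markedTrees_succ_succ]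
      ring

theorem card_treeFinset_zero (n : ℕ) : ((treeFinset 0 n).card : ℝ) = 2 ^ n * markedTrees n 0 := by
  have h := coeff_treeSeries_mul_pow n 0
  rw [pow_zero, mul_one, treeSeries, coeff_mk] at h
  rw [← h]
  field_simp

/-- The equation of `markedSeries_eq` is solved for `markedSeries j a`: the inverse of `1 - X T` is
`T`. -/
theorem markedSeries_eq_add (j a : ℤ) : markedSeries j a =
    C (if j ≤ a then (1 : ℝ) else 0) * treeSeries + C (1 / 2) * (X * (treeSeries * treeSeries)) *
      (markedSeries j (a + 1) + markedSeries j (a - 1)) := by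
  have h := markedSeries_eq j a
  have hc := treeSeries_eq
  linear_combination treeSeries * h - markedSeries j a * hc

/-- Each use of `markedSeries_eq_add` makes one step of the walk and costs a factor `Z`, divisible
by `X`. The remainder after `D = n + 1` rounds does not reach the coefficient of `X^n`. -/
theorem exists_markedSeries_eq (j : ℤ) (D : ℕ) : ∀ a : ℤ, ∃ R : PowerSeries ℝ,
    markedSeries j a = ∑ d ∈ Finset.range D,
      C (walkTail d (j - a)) * (treeSeries * (X * (treeSeries * treeSeries)) ^ d) +
      X ^ D * R := by
  set Z := X * (treeSeries * treeSeries) with hZ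
  induction D with
  | zero => exact fun a => ⟨markedSeries j a, by simp⟩
  | succ D ih =>
    intro a
    obtain ⟨R₁, h₁⟩ := ih (a + 1)
    obtain ⟨R₂, h₂⟩ := ih (a - 1)
    refine ⟨C (1 / 2) * (treeSeries * treeSeries) * (R₁ + R₂), ?_⟩
    have h := markedSeries_eq_add j a
    rw [← hZ] at h
    rw [h, h₁, h₂, Finset.sum_range_succ']
    have h0 : walkTail 0 (j - a) = if j ≤ a then 1 else 0 := by
      simp [walkTail]
    have hs : ∀ d, walkTail (d + 1) (j - a) =
        1 / 2 * (walkTail d (j - (a + 1)) + walkTail d (j - (a - 1))) := by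
      intro d
      rw [walkTail, show j - (a + 1) = j - a - 1 by ring, show j - (a - 1) = j - a + 1 by ring]
      ring
    simp only [h0, hs, map_mul, map_add, pow_zero, mul_one]
    have e : ∑ d ∈ Finset.range D, C (1 / 2 : ℝ) *
        (C (walkTail d (j - (a + 1))) + C (walkTail d (j - (a - 1)))) *
          (treeSeries * Z ^ (d + 1)) = C (1 / 2) * Z *
        (∑ d ∈ Finset.range D, C (walkTail d (j - (a + 1))) * (treeSeries * Z ^ d) +
          ∑ d ∈ Finset.range D, C (walkTail d (j - (a - 1))) * (treeSeries * Z ^ d)) := by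
      rw [← Finset.sum_add_distrib, Finset.mul_sum]
      exact Finset.sum_congr rfl fun d _ => by ring
    rw [e, pow_succ]
    generalize (∑ d ∈ Finset.range D, C (walkTail d (j - (a + 1))) * (treeSeries * Z ^ d)) = S₁
    generalize (∑ d ∈ Finset.range D, C (walkTail d (j - (a - 1))) * (treeSeries * Z ^ d)) = S₂
    rw [hZ]
    ring

theorem totalNodesGE_eq (j a : ℤ) (n : ℕ) : totalNodesGE j a n =
    2 ^ n * ∑ d ∈ Finset.range (n + 1), markedTrees n d * walkTail d (j - a) := by
  obtain ⟨R, h⟩ := exists_markedSeries_eq j (n + 1) a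
  have h' := congrArg (coeff n) h
  rw [map_add, map_sum, coeff_X_pow_mul', if_neg (by omega), add_zero] at h'
  simp only [coeff_C_mul, coeff_treeSeries_mul_pow] at h'
  rw [markedSeries, coeff_mk, div_eq_iff (by positivity)] at h'
  rw [h', mul_comm]
  congr 1
  exact Finset.sum_congr rfl fun d _ => mul_comm _ _

end LabelledTree

/-- `markedTrees n 0` is the Catalan number. -/
theorem markedTrees_zero_mul (n : ℕ) :
    (n + 1) * markedTrees n 0 = (2 * n).choose n := by
  have h := Nat.choose_succ_right_eq (2 * n) n
  rw [show 2 * n - n = n by omega] at h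
  have h' : ((2 * n).choose (n + 1) : ℝ) * (n + 1) = (2 * n).choose n * n := by exact_mod_cast h
  simp only [markedTrees, add_zero]
  linear_combination -h'

/-- The probability that a marked node of a random labelled tree with `n` edges and root label `0`
has label at least `k`. -/
noncomputable def nodeTail (n : ℕ) (k : ℤ) : ℝ :=
  (∑ d ∈ Finset.range (n + 1), markedTrees n d * walkTail d k) / (2 * n).choose n

open LabelledTree in
theorem integral_numNodesGE (j : ℤ) (n : ℕ) :
    ∫ t, (t.numNodesGE j : ℝ) ∂(uniformLaw n) = (n + 1) * nodeTail n j := by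
  have hpos : (0 : ℝ) < (2 * n).choose n := by
    exact_mod_cast Nat.choose_pos (by omega)
  have h0 : (treesRootedAt 0 n) = (treeFinset 0 n : Set LabelledTree) := by
    simp [treeFinset]
  have hm := markedTrees_zero_mul n
  have hn : (n + 1 : ℝ) ≠ 0 := by positivity
  have hm0 : markedTrees n 0 ≠ 0 := by
    rintro h
    rw [h, mul_zero] at hm
    exact hpos.ne hm
  have h1 : ∫ t, (t.numNodesGE j : ℝ) ∂(uniformLaw n) =
      totalNodesGE j 0 n / (treeFinset 0 n).card := by
    rw [uniformLaw, h0]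
    have hint : IntegrableOn (fun t : LabelledTree => (t.numNodesGE j : ℝ))
        (treeFinset 0 n : Set LabelledTree) Measure.count := by
      rw [← (treeFinset 0 n : Set LabelledTree).biUnion_of_singleton]
      refine (integrableOn_finset_iUnion.2 fun t _ => integrableOn_singleton ?_ ?_) <;> simp
    rw [uniformOn, ProbabilityTheory.cond, integral_smul_measure, setIntegral_finset _ hint]
    simp [totalNodesGE, Measure.real, div_eq_inv_mul, Finset.mul_sum]
  rw [h1, totalNodesGE_eq, card_treeFinset_zero, nodeTail, ← hm, sub_zero]
  field_simp

/-! ### Hitting times of the walk and their generating function. -/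

/-- The probability that the simple random walk reaches `k` by time `d`, when `k ≥ 0`. -/
noncomputable def hitBy (d : ℕ) (k : ℤ) : ℝ := walkTail d k + walkTail d (k + 1)

theorem hitBy_zero_right (d : ℕ) : hitBy d 0 = 1 := by
  have := walkTail_symm d 0
  simpa [hitBy] using this

theorem hitBy_zero_left (k : ℕ) : hitBy 0 (k + 1 : ℕ) = 0 := by
  simp only [hitBy, walkTail]
  rw [if_neg (by omega), if_neg (by omega)]
  simp

theorem hitBy_succ (d : ℕ) (k : ℕ) :
    hitBy (d + 1) (k + 1 : ℕ) = (hitBy d k + hitBy d (k + 2 : ℕ)) / 2 := by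
  simp only [hitBy, walkTail]
  push_cast
  rw [show (k : ℤ) + 1 + 1 = k + 2 by ring, show (k : ℤ) + 1 - 1 = k by ring,
    show (k : ℤ) + 2 - 1 = k + 1 by ring]
  ring

theorem hitBy_le_one (d k : ℕ) : hitBy d k ≤ 1 := by
  induction k with
  | zero => exact (hitBy_zero_right d).le
  | succ k ih =>
    have h1 := walkTail_antitone d k
    have h2 := walkTail_antitone d (k + 1)
    refine le_trans ?_ ih
    simp only [hitBy, Nat.cast_add, Nat.cast_one]
    linarith

/-- The probability that the simple random walk hits `k` at time `d` for the first time. -/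
noncomputable def hitAt : ℕ → ℕ → ℝ
  | 0, k => hitBy 0 k
  | d + 1, k => hitBy (d + 1) k - hitBy d k

theorem sum_hitAt (d k : ℕ) : ∑ i ∈ Finset.range (d + 1), hitAt i k = hitBy d k := by
  induction d with
  | zero => simp [hitAt]
  | succ d ih => rw [Finset.sum_range_succ, ih, hitAt]; ring

theorem hitAt_zero_right (d : ℕ) : hitAt d 0 = if d = 0 then 1 else 0 := by
  rcases d with _ | d
  · simp [hitAt, hitBy_zero_right]
  · simp only [hitAt, Nat.cast_zero, hitBy_zero_right]
    simp

theorem hitAt_zero_left (k : ℕ) : hitAt 0 (k + 1) = 0 := hitBy_zero_left k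

/-- Decomposition at the first step. Since all terms on the right are nonnegative, it also yields
the positivity of `hitAt`. -/
theorem hitAt_succ (d k : ℕ) : hitAt (d + 1) (k + 1) = (hitAt d k + hitAt d (k + 2)) / 2 := by
  rcases d with _ | d
  · have h1 := hitBy_succ 0 k
    have h2 := hitBy_zero_left k
    simp only [hitAt, zero_add] at h1 ⊢
    linarith
  · have h1 := hitBy_succ (d + 1) k
    have h2 := hitBy_succ d k
    simp only [hitAt]
    linarith

theorem hitAt_nonneg (d : ℕ) : ∀ k, 0 ≤ hitAt d k := by
  induction d with
  | zero =>
    rintro (_ | k)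
    · simp [hitAt_zero_right]
    · exact (hitAt_zero_left k).ge
  | succ d ih =>
    rintro (_ | k)
    · simp [hitAt_zero_right]
    · rw [hitAt_succ]
      linarith [ih k, ih (k + 2)]

theorem summable_hitAt (k : ℕ) : Summable fun d => hitAt d k := by
  refine summable_of_sum_range_le (c := 1) (fun d => hitAt_nonneg d k) fun n => ?_
  refine le_trans ?_ ((sum_hitAt n k).trans_le (hitBy_le_one n k))
  rw [Finset.sum_range_succ]
  linarith [hitAt_nonneg n k]

theorem tsum_hitAt_le (k : ℕ) : ∑' d, hitAt d k ≤ 1 := by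
  refine Real.tsum_le_of_sum_range_le (fun d => hitAt_nonneg d k) fun n => ?_
  refine le_trans ?_ ((sum_hitAt n k).trans_le (hitBy_le_one n k))
  rw [Finset.sum_range_succ]
  linarith [hitAt_nonneg n k]

theorem norm_hitAt_mul_pow_le (k d : ℕ) {z : ℂ} (hz : ‖z‖ ≤ 1) :
    ‖(hitAt d k : ℂ) * z ^ d‖ ≤ hitAt d k := by
  rw [norm_mul, norm_pow, Complex.norm_real, Real.norm_of_nonneg (hitAt_nonneg d k)]
  exact mul_le_of_le_one_right (hitAt_nonneg d k) (pow_le_one₀ (norm_nonneg z) hz)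

theorem summable_hitAt_mul_pow (k : ℕ) {z : ℂ} (hz : ‖z‖ ≤ 1) :
    Summable fun d => (hitAt d k : ℂ) * z ^ d :=
  (summable_hitAt k).of_norm_bounded fun d => norm_hitAt_mul_pow_le k d hz

/-- The generating function of the hitting time of `k` by the simple random walk. -/
noncomputable def hitGF (k : ℕ) (z : ℂ) : ℂ := ∑' d, (hitAt d k : ℂ) * z ^ d

theorem norm_hitGF_le (k : ℕ) {z : ℂ} (hz : ‖z‖ ≤ 1) : ‖hitGF k z‖ ≤ 1 :=
  (tsum_of_norm_bounded (summable_hitAt k).hasSum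
    fun d => norm_hitAt_mul_pow_le k d hz).trans (tsum_hitAt_le k)

theorem hitGF_zero (z : ℂ) : hitGF 0 z = 1 := by
  rw [hitGF, tsum_eq_single 0]
  · simp [hitAt_zero_right]
  · intro d hd
    simp [hitAt_zero_right, hd]

theorem hitGF_succ (k : ℕ) {z : ℂ} (hz : ‖z‖ ≤ 1) :
    hitGF (k + 1) z = z / 2 * (hitGF k z + hitGF (k + 2) z) := by
  rw [hitGF, (summable_hitAt_mul_pow (k + 1) hz).tsum_eq_zero_add, hitAt_zero_left, hitGF, hitGF,
    ← (summable_hitAt_mul_pow k hz).tsum_add (summable_hitAt_mul_pow (k + 2) hz), ← tsum_mul_left]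
  simp only [Complex.ofReal_zero, zero_mul, zero_add]
  refine tsum_congr fun d => ?_
  rw [hitAt_succ]
  push_cast
  ring

theorem continuousOn_hitGF (k : ℕ) : ContinuousOn (hitGF k) (Metric.closedBall 0 1) := by
  refine continuousOn_tsum (u := fun d => hitAt d k) (fun d => by fun_prop) (summable_hitAt k) ?_
  intro d z hz
  exact norm_hitAt_mul_pow_le k d (by simpa using hz)

/-- The generating function of the hitting time of `1` by the simple random walk. -/
noncomputable def hitRoot (z : ℂ) : ℂ := z / (1 + (1 - z ^ 2) ^ (1 / 2 : ℂ))

/-- The principal root halves the argument. This keeps the denominator of `hitRoot` at norm at least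
`1`, and later bounds the limit integrand. -/
theorem re_sqrt_nonneg (w : ℂ) : 0 ≤ (w ^ (1 / 2 : ℂ)).re := by
  rcases eq_or_ne w 0 with rfl | hw
  · simp
  · rw [Complex.cpow_def_of_ne_zero hw, Complex.exp_re]
    refine mul_nonneg (Real.exp_pos _).le (Real.cos_nonneg_of_mem_Icc ?_)
    have h1 := Complex.neg_pi_lt_arg w
    have h2 := Complex.arg_le_pi w
    have : (Complex.log w * (1 / 2)).im = w.arg / 2 := by
      simp [Complex.mul_im, Complex.log_im]
      ring
    rw [this]
    constructor <;> linarith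

theorem sqrt_sq (w : ℂ) : (w ^ (1 / 2 : ℂ)) ^ 2 = w := by
  rw [one_div, Complex.cpow_ofNat_inv_pow]

theorem one_le_norm_one_add_sqrt (w : ℂ) : 1 ≤ ‖1 + w ^ (1 / 2 : ℂ)‖ := by
  refine le_trans ?_ (Complex.re_le_norm _)
  have := re_sqrt_nonneg w
  simpa using this

theorem one_add_sqrt_ne_zero (w : ℂ) : 1 + w ^ (1 / 2 : ℂ) ≠ 0 := by
  intro h
  have := one_le_norm_one_add_sqrt w
  rw [h, norm_zero] at this
  linarith

theorem norm_hitRoot_le {z : ℂ} (hz : ‖z‖ ≤ 1) : ‖hitRoot z‖ ≤ 1 := by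
  rw [hitRoot, norm_div]
  exact div_le_one_of_le₀ (hz.trans (one_le_norm_one_add_sqrt _)) (norm_nonneg _)

theorem hitRoot_eq (z : ℂ) : hitRoot z = z / 2 * (1 + hitRoot z ^ 2) := by
  have h := one_add_sqrt_ne_zero (1 - z ^ 2)
  have h2 := sqrt_sq (1 - z ^ 2)
  rw [hitRoot]
  field_simp
  linear_combination (-z) * h2

theorem continuousOn_hitRoot : ContinuousOn hitRoot (Metric.closedBall 0 1) := by
  refine ContinuousOn.div continuousOn_id ?_ fun z _ => one_add_sqrt_ne_zero _
  refine continuousOn_const.add ?_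
  intro z hz
  have hc : ContinuousAt (fun w : ℂ => w ^ (1 / 2 : ℂ)) (1 - z ^ 2) := by
    rcases eq_or_ne (1 - z ^ 2) 0 with h | h
    · rw [h]
      exact (Complex.continuousAt_cpow_zero_of_re_pos (by norm_num)).comp
        (f := fun w : ℂ => (w, (1 / 2 : ℂ))) (by fun_prop)
    · refine continuousAt_cpow_const ?_
      rw [Complex.mem_slitPlane_iff]
      -- On the closed disc `1 - z²` has nonnegative real part, so it meets the branch cut only at
      -- `0`, the case treated above.
      by_contra! hcon
      obtain ⟨h1, h2⟩ := hcon
      have hn : ‖z ^ 2‖ ≤ 1 := by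
        rw [norm_pow]
        exact pow_le_one₀ (norm_nonneg _) (by simpa using hz)
      have h3 := (Complex.re_le_norm (z ^ 2)).trans hn
      simp only [Complex.sub_re, Complex.one_re] at h1
      exact h (Complex.ext (by simp only [Complex.sub_re, Complex.one_re, Complex.zero_re]; linarith)
        (by rw [h2]; rfl))
  exact (ContinuousAt.comp (f := fun z : ℂ => 1 - z ^ 2) hc (by fun_prop)).continuousWithinAt

/-- Both sides are bounded by `1`, equal `1` at `k = 0` and satisfy the same linear recursion in
`k`. Each use of the recursion shrinks the bound on their difference by `‖z‖`. -/
theorem hitGF_eq_pow_of_norm_lt {z : ℂ} (hz : ‖z‖ < 1) (k : ℕ) : hitGF k z = hitRoot z ^ k := by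
  have key : ∀ m k, ‖hitGF k z - hitRoot z ^ k‖ ≤ 2 * ‖z‖ ^ m := by
    intro m
    induction m with
    | zero =>
      intro k
      refine (norm_sub_le _ _).trans ?_
      rw [norm_pow]
      have := pow_le_one₀ (n := k) (norm_nonneg _) (norm_hitRoot_le hz.le)
      linarith [norm_hitGF_le k hz.le]
    | succ m ih =>
      rintro (_ | k)
      · rw [hitGF_zero, pow_zero, sub_self, norm_zero]
        positivity
      · have e : hitGF (k + 1) z - hitRoot z ^ (k + 1) = z / 2 *
            ((hitGF k z - hitRoot z ^ k) + (hitGF (k + 2) z - hitRoot z ^ (k + 2))) := by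
          rw [hitGF_succ k hz.le]
          linear_combination (-hitRoot z ^ k) * hitRoot_eq z
        rw [e, norm_mul, norm_div, Complex.norm_two]
        have h := (norm_add_le (hitGF k z - hitRoot z ^ k)
          (hitGF (k + 2) z - hitRoot z ^ (k + 2))).trans (add_le_add (ih k) (ih (k + 2)))
        calc _ ≤ ‖z‖ / 2 * (2 * ‖z‖ ^ m + 2 * ‖z‖ ^ m) := by gcongr
          _ = _ := by ring
  have hlim : Tendsto (fun m : ℕ => 2 * ‖z‖ ^ m) atTop (𝓝 (2 * 0)) :=
    (tendsto_pow_atTop_nhds_zero_of_lt_one (norm_nonneg _) hz).const_mul 2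
  have := ge_of_tendsto' hlim (fun m => key m k)
  rw [mul_zero] at this
  exact sub_eq_zero.1 (norm_le_zero_iff.1 this)

/-- Continuity carries the identity to the unit circle, where the integrals are taken. -/
theorem hitGF_eq_pow {z : ℂ} (hz : ‖z‖ ≤ 1) (k : ℕ) : hitGF k z = hitRoot z ^ k := by
  have h : Set.EqOn (hitGF k) (fun z => hitRoot z ^ k) (Metric.closedBall 0 1) := by
    refine Set.EqOn.of_subset_closure (s := Metric.ball 0 1) ?_ (continuousOn_hitGF k)
      (continuousOn_hitRoot.pow k) Metric.ball_subset_closedBall ?_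
    · intro z hz
      exact hitGF_eq_pow_of_norm_lt (by simpa using hz) k
    · rw [closure_ball _ one_ne_zero]
  exact h (by simpa using hz)

/-! ### Integral representation over the unit circle. -/

theorem integral_exp_int_mul_I (k : ℤ) :
    ∫ θ in (-Real.pi)..Real.pi, Complex.exp (k * (θ * Complex.I)) =
      if k = 0 then (2 * Real.pi : ℂ) else 0 := by
  split_ifs with hk
  · subst hk
    simp
    ring
  · have hc : (k * Complex.I : ℂ) ≠ 0 := by simp [hk]
    have h := integral_exp_mul_complex (a := -Real.pi) (b := Real.pi) hc
    have e : ∀ θ : ℝ, (k * (θ * Complex.I) : ℂ) = k * Complex.I * θ := fun θ => by ring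
    simp_rw [e]
    rw [h, div_eq_zero_iff]
    left
    rw [sub_eq_zero, Complex.exp_eq_exp_iff_exists_int]
    exact ⟨k, by push_cast; ring⟩

/-- Binomial expansion of `2 cos(θ/2) = exp(iθ/2) (1 + exp(-iθ))`; after integration only `m = n +
d` survives. -/
theorem two_mul_cos_pow_mul_exp (n d : ℕ) (θ : ℝ) :
    (2 * Complex.cos (θ / 2)) ^ (2 * n) * Complex.exp (θ * Complex.I) ^ d =
      ∑ m ∈ Finset.range (2 * n + 1), ((2 * n).choose m : ℂ) *
        Complex.exp (((n + d - m : ℤ) : ℂ) * (θ * Complex.I)) := by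
  have h : 2 * Complex.cos (θ / 2) = Complex.exp (θ / 2 * Complex.I) *
      (Complex.exp (-(θ * Complex.I)) + 1) := by
    rw [Complex.two_cos, mul_add, ← Complex.exp_add, mul_one, add_comm]
    congr 2
    ring
  rw [h, mul_pow, add_pow, ← Complex.exp_nat_mul, ← Complex.exp_nat_mul, Finset.mul_sum,
    Finset.sum_mul]
  refine Finset.sum_congr rfl fun m _ => ?_
  rw [one_pow, mul_one, ← Complex.exp_nat_mul]
  have e : Complex.exp (((n + d - m : ℤ) : ℂ) * (θ * Complex.I)) =
      Complex.exp ((2 * n : ℕ) * (θ / 2 * Complex.I)) * Complex.exp (m * -(θ * Complex.I)) *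
        Complex.exp (d * (θ * Complex.I)) := by
    rw [← Complex.exp_add, ← Complex.exp_add]
    congr 1
    push_cast
    ring
  rw [e]
  ring

theorem integral_two_mul_cos_pow_mul_exp (n d : ℕ) :
    ∫ θ in (-Real.pi)..Real.pi, (2 * Complex.cos ((θ : ℝ) / 2)) ^ (2 * n) *
      Complex.exp (θ * Complex.I) ^ d = 2 * Real.pi * (2 * n).choose (n + d) := by
  simp_rw [two_mul_cos_pow_mul_exp]
  rw [intervalIntegral.integral_finsetSum]
  · simp_rw [intervalIntegral.integral_const_mul, integral_exp_int_mul_I]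
    have : ∀ m ∈ Finset.range (2 * n + 1), ((2 * n).choose m : ℂ) *
        (if (n + d - m : ℤ) = 0 then (2 * Real.pi : ℂ) else 0) =
        if m = n + d then ((2 * n).choose m : ℂ) * (2 * Real.pi) else 0 := by
      intro m _
      by_cases hm : m = n + d
      · rw [if_pos hm, if_pos (by omega)]
      · rw [if_neg hm, if_neg (by omega), mul_zero]
    rw [Finset.sum_congr rfl this, Finset.sum_ite_eq']
    split_ifs with hmem
    · ring
    · rw [Nat.choose_eq_zero_of_lt (by simpa using hmem)]
      simp
  · intro m _
    exact Continuous.intervalIntegrable (by fun_prop) _ _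

theorem sum_sub_mul_sum (b a : ℕ → ℝ) (D : ℕ) :
    ∑ d ∈ Finset.range D, (b d - b (d + 1)) * ∑ i ∈ Finset.range (d + 1), a i =
      ∑ d ∈ Finset.range D, b d * a d - b D * ∑ i ∈ Finset.range D, a i := by
  induction D with
  | zero => simp
  | succ D ih =>
    rw [Finset.sum_range_succ, ih, Finset.sum_range_succ (fun d => b d * a d),
      Finset.sum_range_succ a]
    ring

theorem nodeTail_add (n k : ℕ) : nodeTail n k + nodeTail n (k + 1) =
    (∑ d ∈ Finset.range (n + 1), ((2 * n).choose (n + d) : ℝ) * hitAt d k) / (2 * n).choose n := by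
  have h := sum_sub_mul_sum (fun d => ((2 * n).choose (n + d) : ℝ)) (fun d => hitAt d k) (n + 1)
  simp only [sum_hitAt] at h
  -- The boundary term of the Abel summation contains `C(2n, 2n+1) = 0`.
  rw [Nat.choose_eq_zero_of_lt (by omega), Nat.cast_zero, zero_mul, sub_zero] at h
  rw [← h, nodeTail, nodeTail, ← add_div, ← Finset.sum_add_distrib]
  congr 1
  refine Finset.sum_congr rfl fun d _ => ?_
  rw [hitBy, markedTrees, mul_add, add_assoc n d 1]

theorem integral_cos_pow_mul_hitRoot (n k : ℕ) :
    ∫ θ in (-Real.pi)..Real.pi, (2 * Complex.cos ((θ : ℝ) / 2)) ^ (2 * n) *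
      hitRoot (Complex.exp (θ * Complex.I)) ^ k =
        2 * Real.pi * (2 * n).choose n * (nodeTail n k + nodeTail n (k + 1) : ℝ) := by
  have hz : ∀ θ : ℝ, ‖Complex.exp (θ * Complex.I)‖ ≤ 1 := fun θ =>
    (Complex.norm_exp_ofReal_mul_I θ).le
  have hcos : ∀ θ : ℝ, ‖(2 * Complex.cos ((θ : ℝ) / 2)) ^ (2 * n)‖ ≤ 2 ^ (2 * n) := by
    intro θ
    rw [norm_pow]
    refine pow_le_pow_left₀ (norm_nonneg _) ?_ _
    rw [norm_mul, Complex.norm_two, show (θ / 2 : ℂ) = ((θ / 2 : ℝ) : ℂ) by push_cast; rfl,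
      ← Complex.ofReal_cos, Complex.norm_real, Real.norm_eq_abs]
    linarith [Real.abs_cos_le_one (θ / 2)]
  -- The hitting series is integrated term by term: on the circle its terms are dominated by `4^n *
  -- hitAt d k`, which is summable in `d`.
  have h := intervalIntegral.hasSum_integral_of_dominated_convergence
    (μ := volume) (a := -Real.pi) (b := Real.pi)
    (F := fun (d : ℕ) (θ : ℝ) => (2 * Complex.cos ((θ : ℝ) / 2)) ^ (2 * n) *
      ((hitAt d k : ℂ) * Complex.exp (θ * Complex.I) ^ d))
    (f := fun θ : ℝ => (2 * Complex.cos ((θ : ℝ) / 2)) ^ (2 * n) *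
      hitRoot (Complex.exp (θ * Complex.I)) ^ k)
    (fun d _ => 2 ^ (2 * n) * hitAt d k)
    (fun d => Continuous.aestronglyMeasurable (by fun_prop))
    (fun d => Eventually.of_forall fun θ _ => by
      rw [norm_mul]
      exact mul_le_mul (hcos θ) (norm_hitAt_mul_pow_le k d (hz θ)) (norm_nonneg _) (by positivity))
    (Eventually.of_forall fun θ _ => (summable_hitAt k).mul_left _)
    (by simp)
    (Eventually.of_forall fun θ _ => by
      rw [← hitGF_eq_pow (hz θ)]
      exact (summable_hitAt_mul_pow k (hz θ)).hasSum.mul_left _)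
  rw [← h.tsum_eq, nodeTail_add]
  have e : ∀ d : ℕ, ∫ θ in (-Real.pi)..Real.pi, (2 * Complex.cos ((θ : ℝ) / 2)) ^ (2 * n) *
      ((hitAt d k : ℂ) * Complex.exp (θ * Complex.I) ^ d) =
      2 * Real.pi * (((2 * n).choose (n + d) : ℝ) * hitAt d k : ℝ) := by
    intro d
    simp_rw [mul_left_comm _ (hitAt d k : ℂ)]
    rw [intervalIntegral.integral_const_mul, integral_two_mul_cos_pow_mul_exp]
    push_cast
    ring
  simp_rw [e]
  have hpos : ((2 * n).choose n : ℂ) ≠ 0 := by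
    exact_mod_cast (Nat.choose_pos (by omega)).ne'
  rw [tsum_eq_sum (s := Finset.range (n + 1)), ← Finset.mul_sum]
  · push_cast
    field_simp
  · intro d hd
    rw [Nat.choose_eq_zero_of_lt (by simp at hd; omega)]
    simp

/-- The contour integral for the hitting probabilities, with the angle scaled by `√n`. -/
noncomputable def scaledIntegral (n k : ℕ) : ℂ :=
  ∫ s in (-Real.pi * √n)..(Real.pi * √n), (Real.cos (s / √n / 2) : ℂ) ^ (2 * n) *
    hitRoot (Complex.exp ((s / √n : ℝ) * Complex.I)) ^ k

theorem scaledIntegral_eq {n : ℕ} (hn : n ≠ 0) (k : ℕ) : scaledIntegral n k =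
    √n / 4 ^ n * (2 * Real.pi * (2 * n).choose n *
      (nodeTail n k + nodeTail n (k + 1) : ℝ)) := by
  have hs : √(n : ℝ) ≠ 0 := by positivity
  rw [← integral_cos_pow_mul_hitRoot, scaledIntegral]
  have h := intervalIntegral.integral_comp_div (a := -Real.pi * √n) (b := Real.pi * √n)
    (fun θ : ℝ => (Real.cos (θ / 2) : ℂ) ^ (2 * n) *
      hitRoot (Complex.exp (θ * Complex.I)) ^ k) hs
  rw [h, mul_div_cancel_right₀ _ hs, mul_div_cancel_right₀ _ hs, Complex.real_smul, div_mul_eq_mul_div,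
    mul_div_assoc]
  congr 1
  rw [eq_div_iff (by simp), ← intervalIntegral.integral_mul_const]
  refine intervalIntegral.integral_congr fun θ _ => ?_
  rw [mul_pow, pow_mul 2]
  push_cast
  norm_num
  ring

/-- Level `0` is hit at time `0`, so the integral for `k = 0` is the normalising constant. Dividing
by it makes Stirling's formula unnecessary. -/
theorem scaledIntegral_zero_ne_zero {n : ℕ} (hn : n ≠ 0) : scaledIntegral n 0 ≠ 0 ∧
    ∀ k, scaledIntegral n k / scaledIntegral n 0 = (nodeTail n k + nodeTail n (k + 1) : ℝ) := by
  have hs : (√(n : ℝ) : ℂ) ≠ 0 := by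
    have : √(n : ℝ) ≠ 0 := by positivity
    exact_mod_cast this
  have hpos : ((2 * n).choose n : ℂ) ≠ 0 := by
    exact_mod_cast (Nat.choose_pos (by omega)).ne'
  have h1 : nodeTail n (0 : ℕ) + nodeTail n ((0 : ℕ) + 1) = 1 := by
    rw [nodeTail_add]
    simp only [hitAt_zero_right, mul_ite, mul_one, mul_zero, Finset.sum_ite_eq', Finset.mem_range]
    have : ((2 * n).choose n : ℝ) ≠ 0 := by exact_mod_cast hpos
    simp [this]
  have hpi : (Real.pi : ℂ) ≠ 0 := by exact_mod_cast Real.pi_ne_zero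
  have h0 : scaledIntegral n 0 ≠ 0 := by
    rw [scaledIntegral_eq hn, h1]
    simp [hs, hpos, hpi]
  refine ⟨h0, fun k => ?_⟩
  rw [div_eq_iff h0, scaledIntegral_eq hn, scaledIntegral_eq hn, h1]
  push_cast
  ring

/-! ### Asymptotics of the scaled integrals. -/

theorem tendsto_one_add_pow_exp_of_tendsto_mul {w : ℕ → ℂ} {m : ℕ → ℕ} {L : ℂ}
    (hw : Tendsto w atTop (𝓝 0)) (hm : Tendsto (fun n => m n * w n) atTop (𝓝 L)) :
    Tendsto (fun n => (1 + w n) ^ m n) atTop (𝓝 (Complex.exp L)) := by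
  have hd : HasDerivAt (fun w : ℂ => Complex.log (1 + w)) 1 0 := by
    have h := (hasDerivAt_id (0 : ℂ)).const_add 1 |>.clog (by simp)
    simpa using h
  have hs : Tendsto (fun n => dslope (fun w : ℂ => Complex.log (1 + w)) 0 (w n)) atTop (𝓝 1) := by
    have hc := (continuousAt_dslope_same.2 hd.differentiableAt).tendsto.comp hw
    rwa [dslope_same, hd.deriv] at hc
  have hlog : ∀ n, Complex.log (1 + w n) =
      w n * dslope (fun w : ℂ => Complex.log (1 + w)) 0 (w n) := by
    intro n
    have h := sub_smul_dslope (fun w : ℂ => Complex.log (1 + w)) 0 (w n)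
    simpa using h.symm
  have h := (Complex.continuous_exp.tendsto _).comp (hm.mul hs)
  rw [mul_one] at h
  have hne : ∀ᶠ n in atTop, 1 + w n ≠ 0 := by
    have : Tendsto (fun n => 1 + w n) atTop (𝓝 (1 + 0)) := hw.const_add 1
    exact this.eventually_ne (by simp)
  refine h.congr' (hne.mono fun n hn => ?_)
  rw [Function.comp_apply, mul_assoc, ← hlog, Complex.exp_nat_mul, Complex.exp_log hn]

theorem tendsto_sqrt_natCast : Tendsto (fun n : ℕ => √(n : ℝ)) atTop atTop :=
  Real.tendsto_sqrt_atTop.comp tendsto_natCast_atTop_atTop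

theorem tendsto_div_sqrt_natCast (s : ℝ) : Tendsto (fun n : ℕ => s / √(n : ℝ)) atTop (𝓝 0) :=
  tendsto_sqrt_natCast.const_div_atTop s

theorem tendsto_cos_pow (s : ℝ) :
    Tendsto (fun n : ℕ => (Real.cos (s / √n / 2) : ℂ) ^ (2 * n)) atTop
      (𝓝 (Complex.exp ((-(1 / 4) * s ^ 2 : ℝ)))) := by
  have h0 : Tendsto (fun n : ℕ => Real.cos (s / √n / 2) - 1) atTop (𝓝 0) := by
    have h : Tendsto (fun n : ℕ => s / √n / 2) atTop (𝓝 0) := by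
      simpa using (tendsto_div_sqrt_natCast s).div_const 2
    simpa using ((Real.continuous_cos.tendsto 0).comp h).sub_const 1
  -- From `cos x - 1 = -2 sin²(x/2)`, the expression equals `-(s²/4) sinc²(s/(4√n))`.
  have h1 : Tendsto (fun n : ℕ => ((2 * n : ℕ) : ℝ) * (Real.cos (s / √n / 2) - 1)) atTop
      (𝓝 (-(1 / 4) * s ^ 2)) := by
    have h : Tendsto (fun n : ℕ => Real.sinc (s / √n / 4)) atTop (𝓝 1) := by
      have h : Tendsto (fun n : ℕ => s / √n / 4) atTop (𝓝 0) := by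
        simpa using (tendsto_div_sqrt_natCast s).div_const 4
      simpa [Function.comp_def] using (Real.continuous_sinc.tendsto 0).comp h
    have h2 := (h.pow 2).const_mul (-(1 / 4) * s ^ 2)
    rw [one_pow, mul_one] at h2
    refine h2.congr' ?_
    filter_upwards [eventually_gt_atTop 0] with n hn
    have hn' : (0 : ℝ) < n := by exact_mod_cast hn
    rcases eq_or_ne s 0 with rfl | hs
    · simp
    · have hsq := Real.sq_sqrt hn'.le
      have hne : √(n : ℝ) ≠ 0 := by positivity
      rw [Real.sinc_of_ne_zero (by positivity), show s / √(n : ℝ) / 2 = 2 * (s / √n / 4) by ring,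
        Real.cos_two_mul, Real.cos_sq']
      push_cast
      field_simp
      rw [hsq]
      ring
  have h2 := tendsto_one_add_pow_exp_of_tendsto_mul
    (w := fun n : ℕ => ((Real.cos (s / √n / 2) - 1 : ℝ) : ℂ)) (m := fun n => 2 * n)
    (by simpa only [Complex.ofReal_zero] using h0.ofReal)
    (L := ((-(1 / 4) * s ^ 2 : ℝ) : ℂ))
    (by
      refine ((Complex.continuous_ofReal.tendsto _).comp h1).congr fun n => ?_
      simp)
  refine h2.congr fun n => ?_
  push_cast
  ring

theorem ofReal_sq_mul_cpow_half {r : ℝ} (hr : 0 < r) (w : ℂ) :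
    (((r ^ 2 : ℝ) : ℂ) * w) ^ (1 / 2 : ℂ) = r * w ^ (1 / 2 : ℂ) := by
  rcases eq_or_ne w 0 with rfl | hw
  · simp
  · have hr' : (r : ℂ) ≠ 0 := by exact_mod_cast hr.ne'
    rw [Complex.cpow_def_of_ne_zero (mul_ne_zero (by simpa using hr.ne') hw),
      Complex.cpow_def_of_ne_zero hw, Complex.log_ofReal_mul (by positivity) hw, Real.log_pow,
      add_mul, Complex.exp_add]
    congr 1
    push_cast
    rw [Complex.ofReal_log hr.le, show (2 * Complex.log r * (1 / 2) : ℂ) = Complex.log r by ring,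
      Complex.exp_log hr']

theorem rpow_quarter_sq (n : ℕ) : ((n : ℝ) ^ (1 / 4 : ℝ)) ^ 2 = √n := by
  rw [← Real.rpow_natCast, ← Real.rpow_mul (by positivity), Real.sqrt_eq_rpow]
  norm_num

theorem tendsto_rpow_quarter : Tendsto (fun n : ℕ => (n : ℝ) ^ (1 / 4 : ℝ)) atTop atTop :=
  (tendsto_rpow_atTop (by norm_num)).comp tendsto_natCast_atTop_atTop

theorem tendsto_sqrt_mul_exp_sub_one (c : ℂ) : Tendsto (fun n : ℕ =>
    (√n : ℂ) * (Complex.exp (c * ((1 / √n : ℝ) : ℂ)) - 1)) atTop (𝓝 c) := by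
  have hd : HasDerivAt (fun x : ℂ => Complex.exp (c * x)) c 0 := by
    simpa using ((hasDerivAt_id (0 : ℂ)).const_mul c).cexp
  have hw : Tendsto (fun n : ℕ => ((1 / √n : ℝ) : ℂ)) atTop (𝓝[≠] 0) := by
    refine tendsto_nhdsWithin_iff.2 ⟨?_, ?_⟩
    · simpa only [Complex.ofReal_zero] using (tendsto_div_sqrt_natCast 1).ofReal
    · filter_upwards [eventually_gt_atTop 0] with n hn
      have : √(n : ℝ) ≠ 0 := by positivity
      simpa using this
  refine ((hasDerivAt_iff_tendsto_slope.1 hd).comp hw).congr fun n => ?_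
  simp [slope_def_field, div_eq_mul_inv, mul_comm]

/-- With `N = n^(1/4)`, `1 - z²` is about `-2is/N²` and `z - 1` is `O(N⁻²)`, so `hitRoot z - 1` is
about `-√(-2is)/N`. For `s ≠ 0` the number `-2is` is off the branch cut. -/
theorem tendsto_hitRoot_pow {k : ℕ → ℕ} {lam : ℝ}
    (hk : Tendsto (fun n : ℕ => (k n : ℝ) / (n : ℝ) ^ (1 / 4 : ℝ)) atTop (𝓝 lam)) {s : ℝ}
    (hs : s ≠ 0) :
    Tendsto (fun n : ℕ => hitRoot (Complex.exp ((s / √n : ℝ) * Complex.I)) ^ k n) atTop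
      (𝓝 (Complex.exp (-lam * (-2 * Complex.I * s) ^ (1 / 2 : ℂ)))) := by
  set N : ℕ → ℝ := fun n => (n : ℝ) ^ (1 / 4 : ℝ) with hN
  set z : ℕ → ℂ := fun n => Complex.exp ((s / √n : ℝ) * Complex.I) with hz
  have hNinv : Tendsto (fun n => ((N n)⁻¹ : ℂ)) atTop (𝓝 0) := by
    have h := (tendsto_rpow_quarter.inv_tendsto_atTop).ofReal
    rw [Complex.ofReal_zero] at h
    exact h.congr fun n => Complex.ofReal_inv _
  have hNpos : ∀ᶠ n in atTop, 0 < N n := tendsto_rpow_quarter.eventually_gt_atTop 0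
  have h1 : Tendsto (fun n : ℕ => (√n : ℂ) * (1 - z n ^ 2)) atTop (𝓝 (-2 * Complex.I * s)) := by
    have h := (tendsto_sqrt_mul_exp_sub_one (2 * Complex.I * s)).neg
    rw [show -(2 * Complex.I * s) = -2 * Complex.I * s by ring] at h
    refine h.congr fun n => ?_
    rw [hz, ← Complex.exp_nat_mul, ← mul_neg, neg_sub]
    congr 3
    push_cast
    ring_nf
  have h2 : Tendsto (fun n : ℕ => (N n : ℂ) * (1 - z n ^ 2) ^ (1 / 2 : ℂ)) atTop
      (𝓝 ((-2 * Complex.I * s) ^ (1 / 2 : ℂ))) := by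
    have hc : ContinuousAt (fun w : ℂ => w ^ (1 / 2 : ℂ)) (-2 * Complex.I * s) := by
      refine continuousAt_cpow_const ?_
      rw [Complex.mem_slitPlane_iff]
      right
      simpa using hs
    refine (hc.tendsto.comp h1).congr' (hNpos.mono fun n hn => ?_)
    dsimp only
    rw [← ofReal_sq_mul_cpow_half hn, hN, rpow_quarter_sq, Function.comp_apply]
  have h3 : Tendsto (fun n : ℕ => (1 - z n ^ 2) ^ (1 / 2 : ℂ)) atTop (𝓝 0) := by
    have h := hNinv.mul h2
    rw [zero_mul] at h
    refine h.congr' (hNpos.mono fun n hn => ?_)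
    have : (N n : ℂ) ≠ 0 := by exact_mod_cast hn.ne'
    rw [inv_mul_cancel_left₀ this]
  have h4 : Tendsto (fun n : ℕ => (N n : ℂ) * (z n - 1)) atTop (𝓝 0) := by
    have h := hNinv.mul (tendsto_sqrt_mul_exp_sub_one (Complex.I * s))
    rw [zero_mul] at h
    refine h.congr' (hNpos.mono fun n hn => ?_)
    have hne : (N n : ℂ) ≠ 0 := by exact_mod_cast hn.ne'
    have e : (√(n : ℝ) : ℂ) = (N n : ℂ) * N n := by
      rw [← rpow_quarter_sq]
      push_cast
      ring
    rw [e, mul_assoc, inv_mul_cancel_left₀ hne, hz]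
    congr 3
    push_cast
    ring_nf
  have h5 : Tendsto (fun n : ℕ => (N n : ℂ) * (hitRoot (z n) - 1)) atTop
      (𝓝 (-(-2 * Complex.I * s) ^ (1 / 2 : ℂ))) := by
    have h := (h4.sub h2).div (h3.const_add 1) (by simp)
    rw [zero_sub, add_zero, div_one] at h
    refine h.congr fun n => ?_
    have hne := one_add_sqrt_ne_zero (1 - z n ^ 2)
    simp only [Pi.div_apply]
    rw [hitRoot, div_eq_iff hne, mul_assoc, sub_mul, div_mul_cancel₀ _ hne]
    ring
  have h6 : Tendsto (fun n : ℕ => hitRoot (z n) - 1) atTop (𝓝 0) := by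
    have h := hNinv.mul h5
    rw [zero_mul] at h
    refine h.congr' (hNpos.mono fun n hn => ?_)
    have : (N n : ℂ) ≠ 0 := by exact_mod_cast hn.ne'
    rw [inv_mul_cancel_left₀ this]
  have h7 : Tendsto (fun n : ℕ => (k n : ℂ) * (hitRoot (z n) - 1)) atTop
      (𝓝 (-lam * (-2 * Complex.I * s) ^ (1 / 2 : ℂ))) := by
    have h := hk.ofReal.mul h5
    rw [mul_neg, ← neg_mul] at h
    refine h.congr' (hNpos.mono fun n hn => ?_)
    have : (N n : ℂ) ≠ 0 := by exact_mod_cast hn.ne'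
    rw [Complex.ofReal_div, ← mul_assoc, Complex.ofReal_natCast]
    congr 1
    exact div_mul_cancel₀ _ this
  exact (tendsto_one_add_pow_exp_of_tendsto_mul h6 h7).congr fun n => by
    rw [add_sub_cancel]

/-- The limit of the scaled contour integrals. -/
noncomputable def limitIntegral (lam : ℝ) : ℂ :=
  ∫ s : ℝ, Complex.exp ((-(1 / 4) * s ^ 2 : ℝ)) *
    Complex.exp (-lam * (-2 * Complex.I * s) ^ (1 / 2 : ℂ))

/-- For `|x| ≤ π/2`, `cos x ≤ 1 - 2x²/π² ≤ exp(-2x²/π²)`; put `x = s/(2√n)` and raise to the power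
`2n`. -/
theorem norm_cos_pow_le {n : ℕ} (hn : 0 < n) {s : ℝ} (hs : |s| ≤ Real.pi * √n) :
    ‖(Real.cos (s / √n / 2) : ℂ) ^ (2 * n)‖ ≤ Real.exp (-(1 / Real.pi ^ 2) * s ^ 2) := by
  have hpi := Real.pi_pos
  have hn' : (0 : ℝ) < n := by exact_mod_cast hn
  have hsq : 0 < √(n : ℝ) := by positivity
  set x := s / √n / 2 with hx
  have hxabs : |x| ≤ Real.pi / 2 := by
    rw [hx, abs_div, abs_div, abs_of_pos hsq, abs_two]
    gcongr
    rwa [div_le_iff₀ hsq]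
  have h0 : 0 ≤ Real.cos x := Real.cos_nonneg_of_mem_Icc (abs_le.1 hxabs)
  have h1 : Real.cos x ≤ Real.exp (-(2 / Real.pi ^ 2 * x ^ 2)) := by
    refine (Real.cos_le_one_sub_mul_cos_sq (by linarith)).trans ?_
    have := Real.add_one_le_exp (-(2 / Real.pi ^ 2 * x ^ 2))
    linarith
  rw [norm_pow, Complex.norm_real, Real.norm_of_nonneg h0]
  refine (pow_le_pow_left₀ h0 h1 _).trans_eq ?_
  rw [← Real.exp_nat_mul]
  congr 1
  have := Real.sq_sqrt hn'.le
  rw [hx, div_pow, div_pow, this]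
  push_cast
  field_simp

theorem tendsto_scaledIntegral {k : ℕ → ℕ} {lam : ℝ}
    (hk : Tendsto (fun n : ℕ => (k n : ℝ) / (n : ℝ) ^ (1 / 4 : ℝ)) atTop (𝓝 lam)) :
    Tendsto (fun n => scaledIntegral n (k n)) atTop (𝓝 (limitIntegral lam)) := by
  have hpi := Real.pi_pos
  have hz : ∀ θ : ℝ, ‖Complex.exp (θ * Complex.I)‖ ≤ 1 := fun θ =>
    (Complex.norm_exp_ofReal_mul_I θ).le
  have hle : ∀ n : ℕ, -Real.pi * √n ≤ Real.pi * √n := fun n => by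
    have := Real.sqrt_nonneg n
    nlinarith
  have e : ∀ n, scaledIntegral n (k n) = ∫ s, Set.indicator (Set.Ioc (-Real.pi * √n) (Real.pi * √n))
      (fun s => (Real.cos (s / √n / 2) : ℂ) ^ (2 * n) *
        hitRoot (Complex.exp ((s / √n : ℝ) * Complex.I)) ^ k n) s := by
    intro n
    rw [scaledIntegral, intervalIntegral.integral_of_le (hle n),
      integral_indicator measurableSet_Ioc]
  simp_rw [e]
  refine tendsto_integral_filter_of_dominated_convergence
    (fun s => Real.exp (-(1 / Real.pi ^ 2) * s ^ 2)) ?_ ?_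
    (integrable_exp_neg_mul_sq (by positivity)) ?_
  · refine Eventually.of_forall fun n => ?_
    refine AEStronglyMeasurable.indicator (Continuous.aestronglyMeasurable ?_) measurableSet_Ioc
    refine Continuous.mul (by fun_prop) (Continuous.pow ?_ _)
    exact continuousOn_hitRoot.comp_continuous (by fun_prop) fun s => mem_closedBall_zero_iff.2 (hz _)
  · filter_upwards [eventually_gt_atTop 0] with n hn
    refine Eventually.of_forall fun s => ?_
    rw [Set.indicator_apply]
    split_ifs with hs
    · rw [norm_mul, norm_pow (hitRoot _)]
      refine (mul_le_of_le_one_right (norm_nonneg _)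
        (pow_le_one₀ (norm_nonneg _) (norm_hitRoot_le (hz _)))).trans (norm_cos_pow_le hn ?_)
      exact abs_le.2 ⟨by linarith [hs.1], hs.2⟩
    · rw [norm_zero]
      positivity
  · have hae : ∀ᵐ s : ℝ, s ≠ 0 := by simp [ae_iff]
    filter_upwards [hae] with s hs
    refine ((tendsto_cos_pow s).mul (tendsto_hitRoot_pow hk hs)).congr' ?_
    filter_upwards [(tendsto_sqrt_natCast.const_mul_atTop hpi).eventually_gt_atTop |s|] with n hn
    obtain ⟨h1, h2⟩ := abs_lt.1 hn
    rw [Set.indicator_of_mem (Set.mem_Ioc.2 ⟨by linarith, h2.le⟩)]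

/-! ### Evaluation of the limit integral as a series. -/

theorem integral_exp_mul_sqrt_pow (m : ℕ) :
    ∫ s in Set.Ioi (0 : ℝ), Real.exp (-(1 / 4) * s ^ 2) * √(2 * s) ^ m =
      2 ^ m * Real.Gamma (((m : ℝ) + 2) / 4) := by
  have h := integral_rpow_mul_exp_neg_mul_rpow (p := 2) (q := m / 2) (b := 1 / 4) two_pos
    (by have : (0 : ℝ) ≤ m := by positivity
        linarith) (by norm_num)
  have e : ∀ s ∈ Set.Ioi (0 : ℝ), Real.exp (-(1 / 4) * s ^ 2) * √(2 * s) ^ m =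
      2 ^ ((m : ℝ) / 2) * (s ^ ((m : ℝ) / 2) * Real.exp (-(1 / 4) * s ^ (2 : ℝ))) := by
    intro s hs
    have hs' : (0 : ℝ) < s := hs
    rw [Real.sqrt_eq_rpow, ← Real.rpow_natCast _ m, ← Real.rpow_mul (by positivity),
      Real.mul_rpow (by norm_num) hs'.le, Real.rpow_two]
    rw [show (1 / 2 : ℝ) * m = m / 2 by ring]
    ring
  rw [setIntegral_congr_fun measurableSet_Ioi e, integral_const_mul, h]
  have e2 : (1 / 4 : ℝ) ^ (-((m : ℝ) / 2 + 1) / 2) = 2 ^ ((m : ℝ) / 2) * 2 := by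
    rw [show (1 / 4 : ℝ) = 2 ^ (-2 : ℝ) by rw [Real.rpow_neg (by norm_num)]; norm_num,
      ← Real.rpow_mul (by norm_num), ← Real.rpow_add_one (by norm_num)]
    congr 1
    ring
  have e3 : (2 : ℝ) ^ ((m : ℝ) / 2) * 2 ^ ((m : ℝ) / 2) = 2 ^ m := by
    rw [← Real.rpow_add (by norm_num), add_halves, Real.rpow_natCast]
  rw [e2, ← e3]
  rw [show ((m : ℝ) / 2 + 1) / 2 = (m + 2) / 4 by ring]
  ring

theorem hasSum_integral_exp_mul_sqrt (c : ℂ) :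
    HasSum (fun m : ℕ => (2 * c) ^ m / (m.factorial : ℂ) * Real.Gamma (((m : ℝ) + 2) / 4))
      (∫ s in Set.Ioi (0 : ℝ), (Real.exp (-(1 / 4) * s ^ 2) : ℂ) *
        Complex.exp (c * √(2 * s))) := by
  have hexp : ∀ s : ℝ, HasSum (fun m : ℕ => (‖c‖ * √(2 * s)) ^ m / (m.factorial : ℝ))
      (Real.exp (‖c‖ * √(2 * s))) := fun s => by
    rw [Real.exp_eq_exp_ℝ]
    exact NormedSpace.expSeries_div_hasSum_exp _
  have h := hasSum_integral_of_dominated_convergence (μ := volume.restrict (Set.Ioi (0 : ℝ)))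
    (F := fun (m : ℕ) (s : ℝ) => (Real.exp (-(1 / 4) * s ^ 2) : ℂ) *
      ((c * √(2 * s)) ^ m / (m.factorial : ℂ)))
    (f := fun s : ℝ => (Real.exp (-(1 / 4) * s ^ 2) : ℂ) * Complex.exp (c * √(2 * s)))
    (fun m s => Real.exp (-(1 / 4) * s ^ 2) * ((‖c‖ * √(2 * s)) ^ m / (m.factorial : ℝ)))
    (fun m => Continuous.aestronglyMeasurable (by fun_prop))
    (fun m => Eventually.of_forall fun s => by
      rw [norm_mul, Complex.norm_real, Real.norm_of_nonneg (Real.exp_pos _).le, norm_div, norm_pow,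
        norm_mul, Complex.norm_real, Real.norm_of_nonneg (Real.sqrt_nonneg _), Complex.norm_natCast])
    (Eventually.of_forall fun s => ((hexp s).mul_left _).summable)
    (by
      simp_rw [fun s => ((hexp s).mul_left (Real.exp (-(1 / 4) * s ^ 2))).tsum_eq]
      -- The constants come from `‖c‖ √(2s) ≤ ‖c‖²/2 + s` and `s ≤ s²/8 + 2`.
      have hb := ((integrable_exp_neg_mul_sq (b := 1 / 8) (by norm_num)).const_mul
        (Real.exp (‖c‖ ^ 2 / 2 + 2))).restrict (s := Set.Ioi (0 : ℝ))
      refine hb.mono' (Continuous.aestronglyMeasurable (by fun_prop)) ?_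
      refine (ae_restrict_iff' measurableSet_Ioi).2 (Eventually.of_forall fun s hs => ?_)
      have hs' : (0 : ℝ) < s := hs
      rw [Real.norm_of_nonneg (by positivity), ← Real.exp_add, ← Real.exp_add]
      refine Real.exp_le_exp.2 ?_
      have h1 := Real.sq_sqrt (show (0 : ℝ) ≤ 2 * s by positivity)
      nlinarith [sq_nonneg (‖c‖ - √(2 * s)), sq_nonneg (s - 4)])
    (Eventually.of_forall fun s => by
      refine HasSum.mul_left _ ?_
      rw [Complex.exp_eq_exp_ℂ]
      exact NormedSpace.expSeries_div_hasSum_exp _)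
  refine h.congr_fun fun m => ?_
  have e : ∀ s : ℝ, (Real.exp (-(1 / 4) * s ^ 2) : ℂ) * ((c * √(2 * s)) ^ m / (m.factorial : ℂ)) =
      c ^ m / (m.factorial : ℂ) * ((Real.exp (-(1 / 4) * s ^ 2) * √(2 * s) ^ m : ℝ) : ℂ) := by
    intro s
    push_cast
    ring
  simp_rw [e]
  rw [integral_const_mul, integral_complex_ofReal, integral_exp_mul_sqrt_pow]
  push_cast
  ring

theorem neg_two_I_mul_cpow_half {s : ℝ} (hs : 0 < s) :
    (-2 * Complex.I * s) ^ (1 / 2 : ℂ) = √(2 * s) * Complex.exp (-(Real.pi / 4 * Complex.I)) := by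
  have h := ofReal_sq_mul_cpow_half (r := √(2 * s)) (by positivity) (-Complex.I)
  rw [Real.sq_sqrt (by positivity), Complex.cpow_def_of_ne_zero (x := -Complex.I) (by simp),
    Complex.log_neg_I] at h
  rw [show (-2 * Complex.I * s : ℂ) = ((2 * s : ℝ) : ℂ) * -Complex.I by push_cast; ring, h]
  congr 2
  ring

theorem neg_two_I_mul_neg_cpow_half {s : ℝ} (hs : 0 < s) :
    (-2 * Complex.I * (-s : ℝ)) ^ (1 / 2 : ℂ) = √(2 * s) * Complex.exp (Real.pi / 4 * Complex.I) := by
  have h := ofReal_sq_mul_cpow_half (r := √(2 * s)) (by positivity) Complex.I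
  rw [Real.sq_sqrt (by positivity), Complex.cpow_def_of_ne_zero (x := Complex.I) (by simp),
    Complex.log_I] at h
  rw [show (-2 * Complex.I * (-s : ℝ) : ℂ) = ((2 * s : ℝ) : ℂ) * Complex.I by push_cast; ring, h]
  congr 2
  ring

theorem integrable_limitIntegral {lam : ℝ} (hlam : 0 ≤ lam) : Integrable fun s : ℝ =>
    Complex.exp ((-(1 / 4) * s ^ 2 : ℝ)) *
      Complex.exp (-lam * (-2 * Complex.I * s) ^ (1 / 2 : ℂ)) := by
  refine (integrable_exp_neg_mul_sq (b := 1 / 4) (by norm_num)).mono'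
    (Measurable.aestronglyMeasurable (by fun_prop)) (Eventually.of_forall fun s => ?_)
  rw [norm_mul, ← Complex.ofReal_exp, Complex.norm_real, Real.norm_of_nonneg (Real.exp_pos _).le,
    Complex.norm_exp]
  refine mul_le_of_le_one_right (Real.exp_pos _).le (Real.exp_le_one_iff.2 ?_)
  have := re_sqrt_nonneg (-2 * Complex.I * s)
  rw [← Complex.ofReal_neg, Complex.re_ofReal_mul]
  nlinarith

/-- The half-lines `s > 0` and `s < 0` give the expansion with `c = -λ exp(∓iπ/4)`. The two are
conjugate, and the `m`-th powers of the exponentials add up to `2 cos(mπ/4)`. -/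
theorem hasSum_limitIntegral {lam : ℝ} (hlam : 0 ≤ lam) :
    HasSum (fun m : ℕ => ((2 * ((-2 * lam) ^ m / (m.factorial : ℝ) *
      Real.cos (m * Real.pi / 4) * Real.Gamma (((m : ℝ) + 2) / 4)) : ℝ) : ℂ))
      (limitIntegral lam) := by
  have hint := integrable_limitIntegral hlam
  have h1 := hasSum_integral_exp_mul_sqrt (-lam * Complex.exp (-(Real.pi / 4 * Complex.I)))
  have h2 := hasSum_integral_exp_mul_sqrt (-lam * Complex.exp (Real.pi / 4 * Complex.I))
  have e : limitIntegral lam = (∫ s in Set.Ioi (0 : ℝ), (Real.exp (-(1 / 4) * s ^ 2) : ℂ) *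
        Complex.exp (-lam * Complex.exp (-(Real.pi / 4 * Complex.I)) * √(2 * s))) +
      ∫ s in Set.Ioi (0 : ℝ), (Real.exp (-(1 / 4) * s ^ 2) : ℂ) *
        Complex.exp (-lam * Complex.exp (Real.pi / 4 * Complex.I) * √(2 * s)) := by
    have hIic := integral_comp_neg_Ioi (c := 0) (f := fun s : ℝ =>
      Complex.exp ((-(1 / 4) * s ^ 2 : ℝ)) *
        Complex.exp (-lam * (-2 * Complex.I * s) ^ (1 / 2 : ℂ)))
    rw [limitIntegral, ← integral_add_compl measurableSet_Ioi hint (s := Set.Ioi 0), Set.compl_Ioi]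
    rw [neg_zero] at hIic
    rw [← hIic]
    congr 1
    · refine setIntegral_congr_fun measurableSet_Ioi fun s hs => ?_
      rw [neg_two_I_mul_cpow_half hs, Complex.ofReal_exp]
      ring_nf
    · refine setIntegral_congr_fun measurableSet_Ioi fun s hs => ?_
      rw [neg_two_I_mul_neg_cpow_half hs, Complex.ofReal_exp]
      ring_nf
  rw [e]
  refine (h1.add h2).congr_fun fun m => ?_
  have hcos : (Real.cos (m * Real.pi / 4) : ℂ) = (Complex.exp (-(Real.pi / 4 * Complex.I)) ^ m +
      Complex.exp (Real.pi / 4 * Complex.I) ^ m) / 2 := by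
    rw [Complex.ofReal_cos, Complex.cos, ← Complex.exp_nat_mul, ← Complex.exp_nat_mul, add_comm]
    push_cast
    congr 3 <;> ring
  rw [Complex.ofReal_mul, Complex.ofReal_mul, Complex.ofReal_mul, hcos]
  push_cast
  ring

theorem limitIntegral_zero : limitIntegral 0 = (2 * √Real.pi : ℝ) := by
  have h : limitIntegral 0 = ∫ s : ℝ, ((Real.exp (-(1 / 4) * s ^ 2) : ℝ) : ℂ) := by
    rw [limitIntegral]
    refine integral_congr_ae (Eventually.of_forall fun s => ?_)
    simp
  rw [h, integral_complex_ofReal, integral_gaussian]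
  congr 1
  rw [show Real.pi / (1 / 4) = 2 ^ 2 * Real.pi by ring, Real.sqrt_mul (by norm_num),
    Real.sqrt_sq (by norm_num)]

/-! ### From sums of two tails to a single tail, and conclusion. -/

theorem markedTrees_nonneg (n d : ℕ) : 0 ≤ markedTrees n d := by
  have h := Nat.choose_succ_right_eq (2 * n) (n + d)
  have hle : (2 * n).choose (n + d + 1) ≤ (2 * n).choose (n + d) := by
    refine Nat.le_of_mul_le_mul_right (c := n + d + 1) ?_ (by omega)
    rw [h]
    exact Nat.mul_le_mul_left _ (by omega)
  exact sub_nonneg.2 (by exact_mod_cast hle)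

theorem nodeTail_succ_le (n : ℕ) (k : ℤ) : nodeTail n (k + 1) ≤ nodeTail n k := by
  refine div_le_div_of_nonneg_right (Finset.sum_le_sum fun d _ => ?_) (by positivity)
  exact mul_le_mul_of_nonneg_left (walkTail_antitone d k) (markedTrees_nonneg n d)

theorem tendsto_nodeTail_add {k : ℕ → ℕ} {lam S : ℝ}
    (hk : Tendsto (fun n : ℕ => (k n : ℝ) / (n : ℝ) ^ (1 / 4 : ℝ)) atTop (𝓝 lam))
    (hS : limitIntegral lam = S) :
    Tendsto (fun n => nodeTail n (k n) + nodeTail n (k n + 1)) atTop (𝓝 (S / (2 * √Real.pi))) := by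
  have h1 := tendsto_scaledIntegral hk
  have h0 := tendsto_scaledIntegral (k := fun _ => 0) (lam := 0) (by simp)
  have hpi : (0 : ℝ) < 2 * √Real.pi := by positivity
  have h := h1.div h0 (by rw [limitIntegral_zero]; exact_mod_cast hpi.ne')
  rw [limitIntegral_zero, hS, ← Complex.ofReal_div] at h
  have hre := (Complex.continuous_re.tendsto _).comp h
  rw [Complex.ofReal_re] at hre
  refine hre.congr' ?_
  filter_upwards [eventually_ne_atTop 0] with n hn
  rw [Function.comp_apply, Pi.div_apply, (scaledIntegral_zero_ne_zero hn).2, Complex.ofReal_re]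

theorem tendsto_nodeTail {lam S : ℝ} (hlam : 0 ≤ lam) (hS : limitIntegral lam = S) :
    Tendsto (fun n : ℕ => nodeTail n ⌈lam * (n : ℝ) ^ (1 / 4 : ℝ)⌉) atTop
      (𝓝 (S / (2 * √Real.pi) / 2)) := by
  set k : ℕ → ℕ := fun n => ⌈lam * (n : ℝ) ^ (1 / 4 : ℝ)⌉₊ with hk
  have hceil : ∀ n : ℕ, ⌈lam * (n : ℝ) ^ (1 / 4 : ℝ)⌉ = (k n : ℤ) := fun n =>
    (Int.natCast_ceil_eq_ceil (by positivity)).symm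
  have hk0 : Tendsto (fun n : ℕ => (k n : ℝ) / (n : ℝ) ^ (1 / 4 : ℝ)) atTop (𝓝 lam) :=
    (tendsto_nat_ceil_mul_div_atTop hlam).comp tendsto_rpow_quarter
  have hk1 : Tendsto (fun n : ℕ => ((k n + 1 : ℕ) : ℝ) / (n : ℝ) ^ (1 / 4 : ℝ)) atTop
      (𝓝 lam) := by
    have h := hk0.add tendsto_rpow_quarter.inv_tendsto_atTop
    rw [add_zero] at h
    refine h.congr fun n => ?_
    rw [Pi.inv_apply]
    push_cast
    ring
  have hY0 := tendsto_nodeTail_add hk0 hS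
  have hY1 := tendsto_nodeTail_add hk1 hS
  simp_rw [hceil]
  -- Write `t_k` for the tail, nonincreasing in `k`, and `Y_k = t_k + t_{k+1}`. Then `Y_k/2 ≤ t_k =
  -- Y_k - t_{k+1} ≤ Y_k - Y_{k+1}/2`, and `Y_k`, `Y_{k+1}` have the same limit.
  refine tendsto_of_tendsto_of_tendsto_of_le_of_le (hY0.div_const 2)
    (h := fun n => (nodeTail n (k n) + nodeTail n (k n + 1)) -
      (nodeTail n (k n + 1 : ℕ) + nodeTail n ((k n + 1 : ℕ) + 1)) / 2) ?_ ?_ ?_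
  · have h := hY0.sub (hY1.div_const 2)
    rwa [sub_half] at h
  · intro n
    have := nodeTail_succ_le n (k n)
    dsimp only
    linarith
  · intro n
    have := nodeTail_succ_le n (k n + 1)
    dsimp only
    push_cast
    linarith

theorem proposition18 (lam : ℝ) (hlam : 0 ≤ lam) :
    Summable (fun m : ℕ =>
      (-2 * lam) ^ m / (m.factorial : ℝ) * Real.cos (m * Real.pi / 4) *
        Real.Gamma (((m : ℝ) + 2) / 4)) ∧
    Tendsto
      (fun n : ℕ =>
        ∫ t, (t.numNodesGEReal (lam * (n : ℝ) ^ (1 / 4 : ℝ)) : ℝ) / (n : ℝ)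
          ∂(LabelledTree.uniformLaw n))
      atTop
      (𝓝 (1 / (2 * Real.sqrt Real.pi) *
        ∑' m : ℕ, (-2 * lam) ^ m / (m.factorial : ℝ) * Real.cos (m * Real.pi / 4) *
          Real.Gamma (((m : ℝ) + 2) / 4))) := by
  have h := hasSum_limitIntegral hlam
  have hsum : Summable (fun m : ℕ => (-2 * lam) ^ m / (m.factorial : ℝ) *
      Real.cos (m * Real.pi / 4) * Real.Gamma (((m : ℝ) + 2) / 4)) :=
    (summable_mul_left_iff two_ne_zero).1 (Complex.summable_ofReal.1 h.summable)
  refine ⟨hsum, ?_⟩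
  set T := ∑' m : ℕ, (-2 * lam) ^ m / (m.factorial : ℝ) *
      Real.cos (m * Real.pi / 4) * Real.Gamma (((m : ℝ) + 2) / 4) with hT
  have hS : limitIntegral lam = ((2 * T : ℝ) : ℂ) := by
    rw [← h.tsum_eq, ← Complex.ofReal_tsum, tsum_mul_left]
  -- The factor `1 + 1/n` is the number `n + 1` of nodes divided by `n`.
  have hlim := (tendsto_nodeTail hlam hS).mul
    ((tendsto_inv_atTop_zero.comp tendsto_natCast_atTop_atTop).const_add (1 : ℝ))
  rw [add_zero, mul_one, show 2 * T / (2 * √Real.pi) / 2 = 1 / (2 * √Real.pi) * T by ring] at hlim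
  refine hlim.congr' ?_
  filter_upwards [eventually_gt_atTop 0] with n hn
  have hn' : (n : ℝ) ≠ 0 := by positivity
  simp only [LabelledTree.numNodesGEReal]
  rw [integral_div, integral_numNodesGE, Function.comp_apply]
  field_simp
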